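/- **Intersection Lemma.** Let $V$ be a finite-dimensional real vector space with an inner product $\langle\cdot,\cdot\rangle$, let $L^*$ denote the adjoint of $L\in\mathrm{gl}(V)$, let $s\in\mathrm{GL}(V)$, and let $\gamma$ be either the automorphism $\gamma(A)=s^{-1}As$ or the anti-automorphism $\gamma(A)=s^{-1}A^*s$ of the algebra $\mathrm{gl}(V)$ of linear maps $V\to V$. Assume that $\gamma\circ\gamma=\mathrm{id}$. For $\mu\in\mathbb{R}$ put $\mathrm{gl}_\mu(V)=\{A\in\mathrm{gl}(V) : \gamma(A)=\mu A\}$, and let $\mathrm{GL}_\gamma(V)$ be the group of those $g\in\mathrm{GL}(V)$ for which the map $\varphi_g(A)=g^{-1}Ag$ commutes with $\gamma$, that is, $\varphi_g\circ\gamma=\gamma\circ\varphi_g$. Let $L\in\mathrm{gl}_\mu(V)$, and assume that $V$ is indecomposable for the pair $(L,s)$, that is, $V\neq 0$ and there is no decomposition $V=U\oplus W$ into nonzero $L$-invariant subspaces such that * $U$ and $W$ are $s$-invariant, if $\gamma$ is the automorphism $A\mapsto s^{-1}As$; * $U$ and $W$ are orthogonal for the bilinear form $\omega(x,y)=\langle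 x,sy\rangle$, i.e. $\omega(u,w)=\omega(w,u)=0$ for all $u\in U$, $w\in W$, if $\gamma$ is the anti-automorphism $A\mapsto s^{-1}A^*s$. Then $$\{gLg^{-1} : g\in\mathrm{GL}(V)\}\ \cap\ \mathrm{gl}_\mu(V)\ =\ \{gLg^{-1} : g\in\mathrm{GL}_\gamma(V)\}.$$ -/

import Mathlib

open scoped InnerProductSpace

noncomputable section

namespace StructureMap

/-- The two kinds of structure: automorphisms and anti-automorphisms of `gl(V)`. -/
inductive Kind where
  | aut : Kind
  | anti : Kind

variable {V : Type*} [NormedAddCommGroup V] [InnerProductSpace ℝ V]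

/-- `φ_g(L) = g⁻¹ L g`, as a linear map of `gl(V)` to itself. -/
def phi (g : LinearMap.GeneralLinearGroup ℝ V) : Module.End ℝ (Module.End ℝ V) where
  toFun L := (↑g⁻¹ : Module.End ℝ V) * L * (g : Module.End ℝ V)
  map_add' A B := by rw [mul_add, add_mul]
  map_smul' c A := by
    rw [RingHom.id_apply, mul_smul_comm, smul_mul_assoc]

theorem phi_apply (g : LinearMap.GeneralLinearGroup ℝ V) (L : Module.End ℝ V) :
    phi g L = (↑g⁻¹ : Module.End ℝ V) * L * (g : Module.End ℝ V) := rfl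

theorem phi_one : phi (1 : LinearMap.GeneralLinearGroup ℝ V) = 1 := by
  ext1 L
  simp [phi_apply]

theorem phi_mul (g h : LinearMap.GeneralLinearGroup ℝ V) :
    phi (g * h) = phi h * phi g := by
  ext1 L
  simp [phi_apply, mul_assoc]

/-- `ψ_s(L) = s⁻¹ L* s`, where `L*` is the adjoint with respect to the inner product. -/
def psi [FiniteDimensional ℝ V] (s : LinearMap.GeneralLinearGroup ℝ V) :
    Module.End ℝ (Module.End ℝ V) where
  toFun L := (↑s⁻¹ : Module.End ℝ V) * LinearMap.adjoint L * (s : Module.End ℝ V)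
  map_add' A B := by rw [map_add, mul_add, add_mul]
  map_smul' c A := by
    rw [RingHom.id_apply, LinearEquiv.map_smulₛₗ, mul_smul_comm, smul_mul_assoc]
    rfl

/-- The automorphism `φ_s` or the anti-automorphism `ψ_s` with structure map `s`. -/
def gamma [FiniteDimensional ℝ V] :
    Kind → LinearMap.GeneralLinearGroup ℝ V → Module.End ℝ (Module.End ℝ V)
  | Kind.aut, s => phi s
  | Kind.anti, s => psi s

/-- `gl_μ(V)`, the eigenspace of `γ` with eigenvalue `μ`. -/
abbrev glEigen (γ : Module.End ℝ (Module.End ℝ V)) (μ : ℝ) :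
    Submodule ℝ (Module.End ℝ V) :=
  Module.End.eigenspace γ μ

/-- `GL_γ(V)`, the group of those `g` for which `φ_g` commutes with `γ`. -/
def GLgamma (γ : Module.End ℝ (Module.End ℝ V)) :
    Subgroup (LinearMap.GeneralLinearGroup ℝ V) where
  carrier := {g | phi g * γ = γ * phi g}
  one_mem' := by simp [phi_one]
  mul_mem' {g h} hg hh := by
    have hg' : Commute (phi g) γ := hg
    have hh' : Commute (phi h) γ := hh
    show phi (g * h) * γ = γ * phi (g * h)
    rw [phi_mul]
    exact hh'.mul_left hg'
  inv_mem' {g} hg := by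
    have hg' : phi g * γ = γ * phi g := hg
    have h1 : phi g⁻¹ * phi g = 1 := by rw [← phi_mul, mul_inv_cancel, phi_one]
    have h2 : phi g * phi g⁻¹ = 1 := by rw [← phi_mul, inv_mul_cancel, phi_one]
    show phi g⁻¹ * γ = γ * phi g⁻¹
    calc phi g⁻¹ * γ = phi g⁻¹ * (γ * phi g) * phi g⁻¹ := by
          rw [mul_assoc, mul_assoc, h2, mul_one]
      _ = γ * phi g⁻¹ := by rw [← hg', ← mul_assoc, h1, one_mul]

/-- The orbit `{g L g⁻¹ | g ∈ G}` of `L` under a subgroup `G` of `GL(V)`. -/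
def adOrbit (G : Subgroup (LinearMap.GeneralLinearGroup ℝ V)) (L : Module.End ℝ V) :
    Set (Module.End ℝ V) :=
  {M | ∃ g ∈ G, M = (g : Module.End ℝ V) * L * (↑g⁻¹ : Module.End ℝ V)}

/-- The structure given by `s` splits along `V = U ⊕ W`. An automorphism `φ_s` sees `s` as a
linear map (`s ↦ g s g⁻¹` under coordinate changes), so `U` and `W` have to be `s`-invariant. An
anti-automorphism `ψ_s` sees `s` as the bilinear form `ω(x, y) = ⟪x, s y⟫` (`s ↦ g s g*` under
coordinate changes), so `U` and `W` have to be orthogonal with respect to `ω`. -/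
def StructureSplits (s : LinearMap.GeneralLinearGroup ℝ V) (U W : Submodule ℝ V) : Kind → Prop
  | Kind.aut =>
      (∀ u ∈ U, (s : Module.End ℝ V) u ∈ U) ∧ (∀ w ∈ W, (s : Module.End ℝ V) w ∈ W)
  | Kind.anti =>
      ∀ u ∈ U, ∀ w ∈ W,
        ⟪u, (s : Module.End ℝ V) w⟫_ℝ = 0 ∧ ⟪w, (s : Module.End ℝ V) u⟫_ℝ = 0

/-- `V` is indecomposable for the pair `(L, s)`: it is nonzero, and it is not the direct sum of two
nonzero `L`-invariant subspaces along which the structure given by `s` splits. -/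
def Indecomposable (k : Kind) (L : Module.End ℝ V) (s : LinearMap.GeneralLinearGroup ℝ V) : Prop :=
  Nontrivial V ∧
    ∀ U W : Submodule ℝ V, IsCompl U W →
      (∀ u ∈ U, L u ∈ U) → (∀ w ∈ W, L w ∈ W) → StructureSplits s U W k →
        U = ⊥ ∨ W = ⊥

end StructureMap

end

namespace StructureMap

variable {V : Type*} [NormedAddCommGroup V] [InnerProductSpace ℝ V]

/-! Let `M = g L g⁻¹` with `L`, `M` in `gl_μ(V)`. The idea is to correct `g` by some invertible `z`
commuting with `L`, so that conjugation still carries `L` to `M`. The failure of `g` to respect `γ`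
is measured by `r`, which is `g⁻¹ γ(g)` for an automorphism and `γ(g) g` for an anti-automorphism;
applying `γ` to `M g = g L` shows that `r` commutes with `L`.

Indecomposability enters through Fitting's lemma: a `γ`-fixed endomorphism commuting with `L` is
invertible or nilpotent, as its Fitting decomposition splits both `L` and `s`. For an automorphism,
`γ(r) = r⁻¹`, and `r + 1` or `r - 1` is an invertible correction, giving `γ(g z) = ± g z`. For an
anti-automorphism, `r` is `γ`-fixed, and `r` or `-r` is the square of a polynomial `z` in `r`,
giving `γ(h) h = ± 1` for `h = g z⁻¹`. -/

theorem phi_map_mul (s : LinearMap.GeneralLinearGroup ℝ V) (A B : Module.End ℝ V) :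
    phi s (A * B) = phi s A * phi s B := by
  simp [phi_apply, mul_assoc]

theorem phi_map_one (s : LinearMap.GeneralLinearGroup ℝ V) : phi s 1 = 1 := by
  simp [phi_apply]

/-- `GL_γ(V)`-orbits preserve the eigenspaces of `γ`. -/
theorem adOrbit_GLgamma_subset {γ : Module.End ℝ (Module.End ℝ V)} {μ : ℝ} {L : Module.End ℝ V}
    (hL : L ∈ glEigen γ μ) : adOrbit (GLgamma γ) L ⊆ adOrbit ⊤ L ∩ (glEigen γ μ : Set _) := by
  rintro M ⟨g, hg, rfl⟩
  refine ⟨⟨g, Subgroup.mem_top g, rfl⟩, ?_⟩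
  have hg' : phi g⁻¹ * γ = γ * phi g⁻¹ := (GLgamma γ).inv_mem hg
  have h := LinearMap.congr_fun hg' L
  have hM : phi g⁻¹ L = (g : Module.End ℝ V) * L * (↑g⁻¹ : Module.End ℝ V) := by
    rw [phi_apply, inv_inv]
  rw [glEigen, Module.End.mem_eigenspace_iff] at hL
  rw [SetLike.mem_coe, glEigen, Module.End.mem_eigenspace_iff, ← hM]
  rw [Module.End.mul_apply, Module.End.mul_apply, hL, map_smul] at h
  exact h.symm

/-- A criterion for membership in `GL_γ(V)` without inverses. -/
theorem mem_GLgamma_of_forall {γ : Module.End ℝ (Module.End ℝ V)}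
    {h : LinearMap.GeneralLinearGroup ℝ V}
    (H : ∀ A B : Module.End ℝ V, h * B = A * h → h * γ B = γ A * h) : h ∈ GLgamma γ := by
  change phi h * γ = γ * phi h
  ext1 A
  have hA : (h : Module.End ℝ V) * phi h A = A * h := by simp [phi_apply, mul_assoc]
  rw [Module.End.mul_apply, Module.End.mul_apply, phi_apply h (γ A), mul_assoc, ← H _ _ hA,
    Units.inv_mul_cancel_left]

/-- An element with `φ_s(h) = ε h`, `ε ≠ 0`, belongs to `GL_γ(V)` for `γ = φ_s`. -/
theorem mem_GLgamma_phi {s h : LinearMap.GeneralLinearGroup ℝ V} {ε : ℝ} (hε : ε ≠ 0)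
    (hh : phi s (h : Module.End ℝ V) = ε • (h : Module.End ℝ V)) : h ∈ GLgamma (phi s) := by
  refine mem_GLgamma_of_forall fun A B hAB => ?_
  have h1 := congrArg (phi s) hAB
  rw [phi_map_mul, phi_map_mul, hh, smul_mul_assoc, mul_smul_comm] at h1
  exact smul_right_injective _ hε h1

variable [FiniteDimensional ℝ V]

theorem psi_apply (s : LinearMap.GeneralLinearGroup ℝ V) (A : Module.End ℝ V) :
    psi s A = (↑s⁻¹ : Module.End ℝ V) * LinearMap.adjoint A * (s : Module.End ℝ V) := rfl

theorem psi_map_mul (s : LinearMap.GeneralLinearGroup ℝ V) (A B : Module.End ℝ V) :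
    psi s (A * B) = psi s B * psi s A := by
  have h : LinearMap.adjoint (A * B) = LinearMap.adjoint B * LinearMap.adjoint A :=
    LinearMap.adjoint_comp A B
  simp [psi_apply, h, mul_assoc]

theorem psi_map_one (s : LinearMap.GeneralLinearGroup ℝ V) : psi s (1 : Module.End ℝ V) = 1 := by
  have h : LinearMap.adjoint (1 : Module.End ℝ V) = 1 := LinearMap.adjoint_id
  simp [psi_apply, h]

/-! ### Fitting decomposition of `γ`-fixed endomorphisms -/

/-- Powers of a `γ`-fixed endomorphism are `γ`-fixed. -/
theorem gamma_pow_of_fixed {k : Kind} {s : LinearMap.GeneralLinearGroup ℝ V} {t : Module.End ℝ V}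
    (ht : gamma k s t = t) (n : ℕ) : gamma k s (t ^ n) = t ^ n := by
  induction n with
  | zero => cases k <;> simp [gamma, phi_map_one, psi_map_one]
  | succ n ih =>
    cases k with
    | aut => rw [pow_succ]; simp only [gamma] at *; rw [phi_map_mul, ih, ht]
    | anti => rw [pow_succ]; simp only [gamma] at *; rw [psi_map_mul, ih, ht, ← pow_succ', pow_succ]

/-- Polynomials in a `γ`-fixed endomorphism are `γ`-fixed. -/
theorem gamma_aeval_of_fixed {k : Kind} {s : LinearMap.GeneralLinearGroup ℝ V}
    {t : Module.End ℝ V} (ht : gamma k s t = t) (p : Polynomial ℝ) :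
    gamma k s (Polynomial.aeval t p) = Polynomial.aeval t p := by
  simp only [Polynomial.aeval_eq_sum_range, map_sum, map_smul, gamma_pow_of_fixed ht]

/-- The structure splits along kernel and range of a `γ`-fixed endomorphism. -/
theorem structureSplits_ker_range {k : Kind} {s : LinearMap.GeneralLinearGroup ℝ V}
    {t : Module.End ℝ V} (ht : gamma k s t = t) :
    StructureSplits s (LinearMap.ker t) (LinearMap.range t) k := by
  cases k with
  | aut =>
    have h : t * (s : Module.End ℝ V) = s * t := by
      have h : (s : Module.End ℝ V) * phi s t = s * t := congrArg _ ht
      simpa [phi_apply, mul_assoc] using h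
    have h' (v : V) : t ((s : Module.End ℝ V) v) = (s : Module.End ℝ V) (t v) :=
      LinearMap.congr_fun h v
    refine ⟨fun u hu => ?_, ?_⟩
    · rw [LinearMap.mem_ker] at *
      rw [h', hu, map_zero]
    · rintro _ ⟨v, rfl⟩
      exact ⟨_, h' v⟩
  | anti =>
    have h : LinearMap.adjoint t * (s : Module.End ℝ V) = s * t := by
      have h : (s : Module.End ℝ V) * psi s t = s * t := congrArg _ ht
      simpa [psi_apply, mul_assoc] using h
    have h' (v : V) : LinearMap.adjoint t ((s : Module.End ℝ V) v) = (s : Module.End ℝ V) (t v) :=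
      LinearMap.congr_fun h v
    rintro u hu _ ⟨v, rfl⟩
    rw [LinearMap.mem_ker] at hu
    constructor
    · rw [← h', LinearMap.adjoint_inner_right, hu, inner_zero_left]
    · rw [← LinearMap.adjoint_inner_right, h', hu, map_zero, inner_zero_right]

/-- Fitting's lemma for `γ`-fixed endomorphisms commuting with `L`. -/
theorem Indecomposable.isUnit_or_isNilpotent {k : Kind} {s : LinearMap.GeneralLinearGroup ℝ V}
    {L t : Module.End ℝ V} (hV : Indecomposable k L s) (hL : Commute t L)
    (ht : gamma k s t = t) : IsUnit t ∨ IsNilpotent t := by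
  -- Positivity of `n` is needed to pass from `t ^ n` invertible to `t` invertible.
  obtain ⟨n, hn0, hn⟩ :=
    ((Filter.eventually_gt_atTop 0).and t.eventually_isCompl_ker_pow_range_pow).exists
  have hc (v : V) : (t ^ n) (L v) = L ((t ^ n) v) := LinearMap.congr_fun (hL.pow_left n).eq v
  have hker (u : V) (hu : u ∈ LinearMap.ker (t ^ n)) : L u ∈ LinearMap.ker (t ^ n) := by
    rw [LinearMap.mem_ker] at *
    rw [hc, hu, map_zero]
  have hrange (w : V) (hw : w ∈ LinearMap.range (t ^ n)) : L w ∈ LinearMap.range (t ^ n) := by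
    obtain ⟨v, rfl⟩ := hw
    exact ⟨L v, hc v⟩
  rcases hV.2 _ _ hn hker hrange (structureSplits_ker_range (gamma_pow_of_fixed ht n)) with h | h
  · left
    rw [← isUnit_pow_iff hn0.ne']
    exact (LinearMap.isUnit_iff_ker_eq_bot _).2 h
  · exact Or.inr ⟨n, LinearMap.range_eq_bot.1 h⟩

/-! ### Square roots up to sign -/

/-- Every complex number is, up to sign, the square of a real polynomial in itself. -/
theorem exists_polynomial_sq_eq (z : ℂ) :
    ∃ (f : Polynomial ℝ) (ε : ℝ), (ε = 1 ∨ ε = -1) ∧ Polynomial.aeval z f ^ 2 = ε • z := by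
  by_cases hz : z.im = 0
  · have hz' : z = (z.re : ℂ) := Complex.ext rfl (by simp [hz])
    rcases le_total 0 z.re with h | h
    · refine ⟨Polynomial.C (√z.re), 1, Or.inl rfl, ?_⟩
      rw [Polynomial.aeval_C, hz', Complex.coe_algebraMap, ← Complex.ofReal_pow]
      simp [Real.sq_sqrt h]
    · refine ⟨Polynomial.C (√(-z.re)), -1, Or.inr rfl, ?_⟩
      rw [Polynomial.aeval_C, hz', Complex.coe_algebraMap, ← Complex.ofReal_pow]
      simp [Real.sq_sqrt (neg_nonneg.2 h)]
  -- For nonreal `z`, the numbers `1, z` form a real basis of `ℂ`, so a root `y` of `z` is a real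
  -- affine function of `z`.
  · obtain ⟨y, hy⟩ := IsAlgClosed.exists_pow_nat_eq z two_pos
    refine ⟨Polynomial.C (y.im / z.im) * Polynomial.X +
      Polynomial.C (y.re - y.im / z.im * z.re), 1, Or.inl rfl, ?_⟩
    rw [one_smul]
    refine Eq.trans ?_ hy
    congr 1
    have h : y.im / z.im * z.im = y.im := div_mul_cancel₀ _ hz
    apply Complex.ext <;> simp [h]

/-- A unit that is a square up to a nilpotent element is a square if `2` is invertible. -/
theorem exists_sq_eq_of_isNilpotent_sub {A : Type*} [CommRing A] (h2 : IsUnit (2 : A)) {a w : A}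
    (ha : IsUnit a) (hw : IsNilpotent (w ^ 2 - a)) : ∃ y : A, y ^ 2 = a := by
  have hwu : IsUnit w := by
    rw [← isUnit_pow_iff two_ne_zero, ← add_sub_cancel a (w ^ 2)]
    exact hw.isUnit_add_left_of_commute ha (Commute.all _ _)
  let P : Polynomial A := Polynomial.X ^ 2 - Polynomial.C a
  -- Newton's method for `X ^ 2 - a` starting at `w`, where the derivative `2 w` is a unit.
  obtain ⟨y, ⟨-, hy⟩, -⟩ :=
    Polynomial.existsUnique_nilpotent_sub_and_aeval_eq_zero (P := P) (x := w)
      (by simpa [P] using hw) (by simpa [P, one_add_one_eq_two] using h2.mul hwu)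
  exact ⟨y, by simpa [P, sub_eq_zero] using hy⟩

/-- An element of a finite-dimensional commutative subalgebra that is invertible in the ambient
algebra is invertible in the subalgebra. -/
theorem isUnit_adjoin_singleton {r : Module.End ℝ V} (hr : IsUnit r) :
    IsUnit (⟨r, Algebra.self_mem_adjoin_singleton ℝ r⟩ : Algebra.adjoin ℝ {r}) := by
  have : IsArtinianRing (Algebra.adjoin ℝ {r}) := IsArtinianRing.of_finite ℝ _
  -- Unlike invertibility, being a non-zero-divisor passes trivially to a subring.
  rw [IsArtinianRing.isUnit_iff_mem_nonZeroDivisors, mem_nonZeroDivisors_iff_right]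
  intro x hx
  rw [Subtype.ext_iff] at hx ⊢
  exact (hr.mul_left_eq_zero).1 hx

/-- An approximate square root of `ε r` among the polynomials in `r` yields an exact one. -/
theorem exists_aeval_sq_eq_of_isNilpotent {r : Module.End ℝ V} (hr : IsUnit r) {ε : ℝ}
    (hε : ε ≠ 0) {f : Polynomial ℝ} (hf : IsNilpotent (Polynomial.aeval r f ^ 2 - ε • r)) :
    ∃ p : Polynomial ℝ, Polynomial.aeval r p ^ 2 = ε • r := by
  have hunit {c : ℝ} (hc : c ≠ 0) : IsUnit (algebraMap ℝ (Algebra.adjoin ℝ {r}) c) :=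
    (isUnit_iff_ne_zero.2 hc).map _
  obtain ⟨y, hy⟩ := exists_sq_eq_of_isNilpotent_sub (A := Algebra.adjoin ℝ {r})
    (a := algebraMap ℝ _ ε * ⟨r, Algebra.self_mem_adjoin_singleton ℝ r⟩)
    (w := ⟨Polynomial.aeval r f, Polynomial.aeval_mem_adjoin_singleton ℝ r⟩)
    (by simpa only [map_ofNat] using hunit two_ne_zero)
    ((hunit hε).mul (isUnit_adjoin_singleton hr)) (by
      obtain ⟨n, hn⟩ := hf
      refine ⟨n, Subtype.ext ?_⟩
      rw [Algebra.smul_def] at hn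
      exact hn)
  obtain ⟨p, hp⟩ : ∃ p : Polynomial ℝ, Polynomial.aeval r p = y :=
    (Algebra.adjoin_singleton_eq_range_aeval ℝ r).le y.2
  refine ⟨p, ?_⟩
  rw [hp, Algebra.smul_def]
  exact congrArg Subtype.val hy

/-- If every real polynomial in an invertible `r` is invertible or nilpotent, then `r` or `-r` has
a square root among the polynomials in `r`. -/
theorem exists_aeval_sq_eq [Nontrivial V] {r : Module.End ℝ V} (hr : IsUnit r)
    (h : ∀ p : Polynomial ℝ, IsUnit (Polynomial.aeval r p) ∨ IsNilpotent (Polynomial.aeval r p)) :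
    ∃ (p : Polynomial ℝ) (ε : ℝ), (ε = 1 ∨ ε = -1) ∧ Polynomial.aeval r p ^ 2 = ε • r := by
  have hint : IsIntegral ℝ r := Algebra.IsIntegral.isIntegral r
  obtain ⟨z, hz⟩ := IsAlgClosed.exists_aeval_eq_zero ℂ (minpoly ℝ r)
    (minpoly.degree_pos hint).ne'
  obtain ⟨f, ε, hε, hf⟩ := exists_polynomial_sq_eq z
  obtain ⟨m, hm⟩ := minpoly.dvd ℝ z hz
  have hzint : IsIntegral ℝ z := Algebra.IsIntegral.isIntegral z
  have hnil : IsNilpotent (Polynomial.aeval r (minpoly ℝ z)) := by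
    -- Otherwise the cofactor `m`, of smaller degree than `minpoly ℝ r`, would annihilate `r`.
    refine (h _).resolve_left fun hu => ?_
    have h0 : Polynomial.aeval r (minpoly ℝ z) * Polynomial.aeval r m = 0 := by
      rw [← map_mul, ← hm, minpoly.aeval]
    have hm0 : m ≠ 0 := by
      rintro rfl
      exact minpoly.ne_zero hint (by rw [hm, mul_zero])
    have hd := Polynomial.natDegree_le_of_dvd
      (minpoly.dvd ℝ r ((hu.mul_right_eq_zero).1 h0)) hm0
    rw [hm, Polynomial.natDegree_mul (minpoly.ne_zero hzint) hm0] at hd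
    have := minpoly.natDegree_pos hzint
    omega
  obtain ⟨q, hq⟩ : minpoly ℝ z ∣ f ^ 2 - Polynomial.C ε * Polynomial.X := by
    apply minpoly.dvd
    simp [hf]
  have hε0 : ε ≠ 0 := by rcases hε with rfl | rfl <;> norm_num
  have hf' : IsNilpotent (Polynomial.aeval r f ^ 2 - ε • r) := by
    have : Polynomial.aeval r f ^ 2 - ε • r =
        Polynomial.aeval r (minpoly ℝ z) * Polynomial.aeval r q := by
      rw [← map_mul, ← hq]
      simp [Algebra.smul_def]
    rw [this]
    exact ((Commute.all (minpoly ℝ z) q).map (Polynomial.aeval r)).isNilpotent_mul_right hnil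
  obtain ⟨p, hp⟩ := exists_aeval_sq_eq_of_isNilpotent hr hε0 hf'
  exact ⟨p, ε, hε, hp⟩

/-! ### Correcting the conjugating element -/

/-- An element with `ψ_s(h) h = ε`, `ε ≠ 0`, belongs to `GL_γ(V)` for `γ = ψ_s`. -/
theorem mem_GLgamma_psi {s h : LinearMap.GeneralLinearGroup ℝ V} {ε : ℝ} (hε : ε ≠ 0)
    (hh : psi s (h : Module.End ℝ V) * (h : Module.End ℝ V) = ε • 1) : h ∈ GLgamma (psi s) := by
  refine mem_GLgamma_of_forall fun A B hAB => ?_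
  have h1 := congrArg (psi s) hAB
  rw [psi_map_mul, psi_map_mul] at h1
  have hh' : (h : Module.End ℝ V) * psi s (h : Module.End ℝ V) = ε • 1 := by
    rw [← Units.mul_left_inj h, mul_assoc, hh, mul_smul_comm, smul_mul_assoc, one_mul, mul_one]
  have h2 : (h : Module.End ℝ V) * (psi s B * psi s h) * h = h * (psi s h * psi s A) * h := by
    rw [h1]
  refine smul_right_injective _ hε ?_
  calc ε • ((h : Module.End ℝ V) * psi s B) = h * psi s B * (ε • 1) := by
        rw [mul_smul_comm, mul_one]
    _ = h * (psi s B * psi s h) * h := by rw [← hh]; simp only [mul_assoc]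
    _ = (h * psi s h) * (psi s A * h) := by rw [h2]; simp only [mul_assoc]
    _ = ε • (psi s A * h) := by rw [hh', smul_mul_assoc, one_mul]

/-- Endomorphisms in `gl_μ(V)` that are conjugate under `GL(V)` are conjugate under `GL_γ(V)`,
for an involutive automorphism `γ = φ_s`. -/
theorem exists_mem_GLgamma_phi {s g : LinearMap.GeneralLinearGroup ℝ V} {μ : ℝ}
    {L M : Module.End ℝ V} (hγ : gamma Kind.aut s * gamma Kind.aut s = 1)
    (hL : phi s L = μ • L) (hM : phi s M = μ • M) (hV : Indecomposable Kind.aut L s)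
    (hg : M * g = g * L) :
    ∃ h ∈ GLgamma (phi s), M * (h : Module.End ℝ V) = h * L := by
  have hinv (A : Module.End ℝ V) : phi s (phi s A) = A := LinearMap.congr_fun hγ A
  let r : LinearMap.GeneralLinearGroup ℝ V := g⁻¹ * (s⁻¹ * g * s)
  have hgr : phi s (g : Module.End ℝ V) = g * r := by
    simp [r, phi_apply, mul_assoc]
  have hr : phi s (r : Module.End ℝ V) = (↑r⁻¹ : Module.End ℝ V) := by
    have h := congrArg (phi s) hgr
    rw [hinv, phi_map_mul, hgr, mul_assoc] at h
    exact (Units.inv_eq_of_mul_eq_one_right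
      ((Units.mul_right_inj g).1 (h.symm.trans (mul_one _).symm))).symm
  have hr' : phi s (↑r⁻¹ : Module.End ℝ V) = r := by rw [← hr, hinv]
  have hrL : Commute (r : Module.End ℝ V) L := by
    rcases eq_or_ne μ 0 with rfl | hμ
    · rw [zero_smul] at hL
      have : L = 0 := by rw [← hinv L, hL, map_zero]
      rw [this]
      exact Commute.zero_right _
    · have h := congrArg (phi s) hg
      rw [phi_map_mul, phi_map_mul, hL, hM, hgr, smul_mul_assoc, mul_smul_comm] at h
      have h := smul_right_injective _ hμ h
      rw [← mul_assoc, hg, mul_assoc, mul_assoc] at h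
      exact ((Units.mul_right_inj g).1 h).symm
  have hrL' : Commute (↑r⁻¹ : Module.End ℝ V) L := hrL.units_inv_left
  obtain ⟨ε, hε, hz⟩ : ∃ ε : ℝ, (ε = 1 ∨ ε = -1) ∧ IsUnit ((r : Module.End ℝ V) + ε • 1) := by
    -- As `ε² = 1`, `(r + ε)² = r (r + r⁻¹ + 2ε)`, and the last factor is `γ`-fixed.
    have hsq {ε : ℝ} (hε : ε = 1 ∨ ε = -1)
        (h : IsUnit ((r : Module.End ℝ V) + ↑r⁻¹ + (2 * ε) • 1)) :
        IsUnit ((r : Module.End ℝ V) + ε • 1) := by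
      rw [← isUnit_pow_iff two_ne_zero]
      convert r.isUnit.mul h using 1
      have : ε * ε = 1 := by rcases hε with rfl | rfl <;> norm_num
      simp only [sq, mul_add, add_mul, Units.mul_inv, mul_smul_comm, smul_mul_assoc, mul_one,
        one_mul, smul_add, smul_smul, this, one_smul, two_mul, add_smul]
      abel
    have hfix : gamma Kind.aut s ((r : Module.End ℝ V) + ↑r⁻¹ + (2 * (-1 : ℝ)) • 1) =
        (r : Module.End ℝ V) + ↑r⁻¹ + (2 * (-1 : ℝ)) • 1 := by
      change phi s _ = _
      rw [map_add, map_add, map_smul, hr, hr', phi_map_one, add_comm (r : Module.End ℝ V)]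
    rcases hV.isUnit_or_isNilpotent
      ((hrL.add_left hrL').add_left ((Commute.one_left L).smul_left _)) hfix with h | h
    · exact ⟨-1, Or.inr rfl, hsq (Or.inr rfl) h⟩
    -- If `r + r⁻¹ - 2` is nilpotent, then `r + r⁻¹ + 2` is the unit `4` plus a nilpotent.
    · refine ⟨1, Or.inl rfl, hsq (Or.inl rfl) ?_⟩
      have h4 : IsUnit ((4 : ℝ) • (1 : Module.End ℝ V)) := by
        rw [← Algebra.algebraMap_eq_smul_one]
        exact (isUnit_iff_ne_zero.2 four_ne_zero).map _
      have key : (r : Module.End ℝ V) + ↑r⁻¹ + (2 * (1 : ℝ)) • 1 =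
          (4 : ℝ) • 1 + ((r : Module.End ℝ V) + ↑r⁻¹ + (2 * (-1 : ℝ)) • 1) := by
        module
      rw [key]
      exact h.isUnit_add_left_of_commute h4 ((Commute.one_right _).smul_right _)
  obtain ⟨z, hz⟩ := hz
  have hε0 : ε ≠ 0 := by rcases hε with rfl | rfl <;> norm_num
  refine ⟨g * z, mem_GLgamma_phi hε0 ?_, ?_⟩
  -- `γ(g z) = g r (r⁻¹ + ε) = g (1 + ε r) = ε g z`.
  · have hεε : ε * ε = 1 := by rcases hε with rfl | rfl <;> norm_num
    rw [Units.val_mul, phi_map_mul, hgr, hz, map_add, map_smul, phi_map_one, hr, mul_assoc,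
      ← mul_smul_comm]
    congr 1
    rw [mul_add, Units.mul_inv, mul_smul_comm, mul_one, smul_add, smul_smul, hεε, one_smul,
      add_comm]
  · have hzL : (z : Module.End ℝ V) * L = L * z := by
      rw [hz]
      exact (hrL.add_left ((Commute.one_left L).smul_left _)).eq
    rw [Units.val_mul, ← mul_assoc, hg, mul_assoc, mul_assoc, hzL]

/-- Endomorphisms in `gl_μ(V)` that are conjugate under `GL(V)` are conjugate under `GL_γ(V)`,
for an involutive anti-automorphism `γ = ψ_s`. -/
theorem exists_mem_GLgamma_psi {s g : LinearMap.GeneralLinearGroup ℝ V} {μ : ℝ}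
    {L M : Module.End ℝ V} (hγ : gamma Kind.anti s * gamma Kind.anti s = 1)
    (hL : psi s L = μ • L) (hM : psi s M = μ • M) (hV : Indecomposable Kind.anti L s)
    (hg : M * g = g * L) :
    ∃ h ∈ GLgamma (psi s), M * (h : Module.End ℝ V) = h * L := by
  have : Nontrivial V := hV.1
  have hinv (A : Module.End ℝ V) : psi s (psi s A) = A := LinearMap.congr_fun hγ A
  set r : Module.End ℝ V := psi s g * g with hr_def
  have hr : IsUnit r := by
    refine IsUnit.mul ?_ g.isUnit
    refine ⟨⟨psi s g, psi s (↑g⁻¹ : Module.End ℝ V), ?_, ?_⟩, rfl⟩ <;>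
      simp [← psi_map_mul, psi_map_one]
  have hfix : gamma Kind.anti s r = r := by
    change psi s r = r
    rw [hr_def, psi_map_mul, hinv]
  have hrL : Commute r L := by
    rcases eq_or_ne μ 0 with rfl | hμ
    · rw [zero_smul] at hL
      have : L = 0 := by rw [← hinv L, hL, map_zero]
      rw [this]
      exact Commute.zero_right _
    · have h := congrArg (psi s) hg
      rw [psi_map_mul, psi_map_mul, hL, hM, smul_mul_assoc, mul_smul_comm] at h
      have h := smul_right_injective _ hμ h
      change r * L = L * r
      rw [hr_def, mul_assoc, ← hg, ← mul_assoc, ← mul_assoc]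
      exact congrArg (· * (g : Module.End ℝ V)) h
  have hpL (p : Polynomial ℝ) : Commute (Polynomial.aeval r p) L :=
    Algebra.commute_of_mem_adjoin_singleton_of_commute
      (Polynomial.aeval_mem_adjoin_singleton ℝ r) hrL.symm |>.symm
  obtain ⟨p, ε, hε, hp⟩ := exists_aeval_sq_eq hr fun p =>
    hV.isUnit_or_isNilpotent (hpL p) (gamma_aeval_of_fixed hfix p)
  have hε0 : ε ≠ 0 := by rcases hε with rfl | rfl <;> norm_num
  have hεε : ε * ε = 1 := by rcases hε with rfl | rfl <;> norm_num
  have hz : IsUnit (Polynomial.aeval r p) := by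
    rw [← isUnit_pow_iff two_ne_zero, hp, Algebra.smul_def]
    exact ((isUnit_iff_ne_zero.2 hε0).map _).mul hr
  obtain ⟨z, hz⟩ := hz
  have hzL : Commute (z : Module.End ℝ V) L := hz ▸ hpL p
  have hzfix : psi s (z : Module.End ℝ V) = z := hz ▸ gamma_aeval_of_fixed hfix p
  rw [← hz] at hp
  refine ⟨g * z⁻¹, mem_GLgamma_psi hε0 ?_, ?_⟩
  · set h := g * z⁻¹
    have hgz : (g : Module.End ℝ V) = h * z := by simp [h]
    -- Multiplied by `z` on both sides, the claim becomes `r = ε z²`, since `γ(z) = z` and `g = h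
    -- z`.
    rw [← Units.mul_left_inj z, ← Units.mul_right_inj z]
    calc (z : Module.End ℝ V) * (psi s h * h * z) = r := by
          rw [hr_def, hgz, psi_map_mul, hzfix]
          simp only [mul_assoc]
      _ = z * (ε • 1 * z) := by
          rw [smul_mul_assoc, one_mul, mul_smul_comm, ← sq, hp, smul_smul, hεε, one_smul]
  · rw [Units.val_mul, ← mul_assoc, hg, mul_assoc, mul_assoc, hzL.units_inv_left.eq]

/-- Endomorphisms in `gl_μ(V)` that are conjugate under `GL(V)` are conjugate under `GL_γ(V)`. -/
theorem exists_mem_GLgamma {k : Kind} {s g : LinearMap.GeneralLinearGroup ℝ V} {μ : ℝ}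
    {L M : Module.End ℝ V} (hγ : gamma k s * gamma k s = 1)
    (hL : gamma k s L = μ • L) (hM : gamma k s M = μ • M) (hV : Indecomposable k L s)
    (hg : M * g = g * L) :
    ∃ h ∈ GLgamma (gamma k s), M * (h : Module.End ℝ V) = h * L :=
  match k with
  | Kind.aut => exists_mem_GLgamma_phi hγ hL hM hV hg
  | Kind.anti => exists_mem_GLgamma_psi hγ hL hM hV hg

end StructureMap

theorem mainTheorem6 {V : Type*} [NormedAddCommGroup V] [InnerProductSpace ℝ V]
    [FiniteDimensional ℝ V] (k : StructureMap.Kind) (s : LinearMap.GeneralLinearGroup ℝ V)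
    (hγ : StructureMap.gamma k s * StructureMap.gamma k s = 1)
    (μ : ℝ) (L : Module.End ℝ V)
    (hL : L ∈ StructureMap.glEigen (StructureMap.gamma k s) μ)
    (hV : StructureMap.Indecomposable k L s) :
    StructureMap.adOrbit ⊤ L ∩ (StructureMap.glEigen (StructureMap.gamma k s) μ : Set (Module.End ℝ V))
      = StructureMap.adOrbit (StructureMap.GLgamma (StructureMap.gamma k s)) L := by
  refine Set.Subset.antisymm ?_ (StructureMap.adOrbit_GLgamma_subset hL)
  rintro M ⟨⟨g, -, hg⟩, hM⟩
  rw [SetLike.mem_coe, StructureMap.glEigen, Module.End.mem_eigenspace_iff] at hM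
  rw [StructureMap.glEigen, Module.End.mem_eigenspace_iff] at hL
  obtain ⟨h, hh, hML⟩ := StructureMap.exists_mem_GLgamma hγ hL hM hV
    (show M * (g : Module.End ℝ V) = g * L by rw [hg, mul_assoc, Units.inv_mul, mul_one])
  exact ⟨h, hh, (Units.eq_mul_inv_iff_mul_eq h).2 hML⟩
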